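/- Let $n\ge 3$, write $[n]=\{1,\dots,n\}$ and read indices modulo $n$. For discrete random variables $A_1,\dots,A_n$ (with finite or countable sets of outcomes) and $S\subseteq[n]$, let $H(A_S)$ be the Shannon entropy, in bits, of the tuple $A_S=(A_i)_{i\in S}$, with $H(A_\emptyset)=0$; all entropies are assumed to be finite. A linear inequality $\sum_{S\subseteq[n]}c_S\,H(A_S)\ge 0$ with real coefficients $c_S$ is a *valid entropic inequality* if it holds for all such $A_1,\dots,A_n$. It is *Shannon-type* if its coefficient vector is a finite non-negative linear combination of the coefficient vectors of the basic inequalities $H(A_S)\ge 0$, $-H(A_\emptyset)\ge 0$, $H(A_T)-H(A_S)\ge 0$ for $S\subseteq T$, and $H(A_S)+H(A_T)-H(A_{S\cap T})-H(A_{S\cup T})\ge 0$, where $S,T\subseteq[n]$. A *polymatroid* on $[n]$ is a function $f:2^{[n]}\to\mathbb R$ with $f\ge 0$, $f(\emptyset)=0$, $f(S)\le f(T)$ for $S\subseteq T$, and $f(S\cap T)+f(S\cup T)\le f(S)+f(T)$ for all $S,T$. It is *entropic* if $f(S)=H(A_S)$ for all $S\subseteq[n]$, for some $A_1,\dots,A_n$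 as above. Let $\mathcal C_n$ be the family of all subsets of the sets $\{j,j+1\}$, $j\in[n]$. A *partial polymatroid* on $\mathcal C_n$ is a function $f:\mathcal C_n\to\mathbb R$ which satisfies the same conditions whenever all the sets occurring in them lie in $\mathcal C_n$. It is *non-contextual* if it is the restriction to $\mathcal C_n$ of a polymatroid on $[n]$, and *entropic* if it is the restriction of an entropic polymatroid on $[n]$. Then the following hold. 1. Every valid entropic inequality containing only terms $H(A_j)$ and $H(A_jA_{j+1})$, $j\in[n]$ (that is, $c_S=0$ unless $S=\{j\}$ or $S=\{j,j+1\}$ for some $j$), is Shannon-type. 2. Every integer-valued non-contextual partial polymatroid on $\mathcal C_n$ is the restriction to $\mathcal C_n$ of a finite sum of $\{0,1\}$-valued entropic polymatroids on $[n]$, and it is entropic. -/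

import Mathlib

namespace EntropicCycle

noncomputable section

/-- The basic inequalities for a function on the subsets of `[n]` (indexed by `Fin n`):
non-negativity, normalization, monotonicity and submodularity. -/
structure IsPolymatroid {n : ℕ} (f : Finset (Fin n) → ℝ) : Prop where
  nonneg : ∀ S, 0 ≤ f S
  empty : f ∅ = 0
  mono : ∀ S T, S ⊆ T → f S ≤ f T
  submod : ∀ S T, f (S ∩ T) + f (S ∪ T) ≤ f S + f T

/-- A marginal scenario: a non-empty, downward closed family of subsets of `[n]`. -/
structure MarginalScenario (n : ℕ) where
  faces : Set (Finset (Fin n))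
  nonempty : faces.Nonempty
  down_closed : ∀ S ∈ faces, ∀ T, T ⊆ S → T ∈ faces

/-- The marginal scenario generated by a non-empty set system. -/
def MarginalScenario.generated {n : ℕ} (X : Set (Finset (Fin n))) (hX : X.Nonempty) :
    MarginalScenario n where
  faces := {S | ∃ T ∈ X, S ⊆ T}
  nonempty := hX.imp fun T hT => ⟨T, hT, subset_rfl⟩
  down_closed := fun _ ⟨U, hU, hSU⟩ _ hTS => ⟨U, hU, hTS.trans hSU⟩

/-- The `n`-cycle scenario, generated by the sets `{j, j+1}`; addition in `Fin n` is modulo `n`. -/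
def cycleScenario (n : ℕ) [NeZero n] : MarginalScenario n :=
  MarginalScenario.generated (Set.range fun j : Fin n => ({j, j + 1} : Finset (Fin n)))
    (Set.range_nonempty _)

/-- A partial polymatroid on `M`: the basic inequalities are required whenever all the sets which
occur belong to `M`. -/
structure IsPartialPolymatroid {n : ℕ} (M : MarginalScenario n) (f : M.faces → ℝ) : Prop where
  nonneg : ∀ S, 0 ≤ f S
  empty : ∀ S : M.faces, S.1 = ∅ → f S = 0
  mono : ∀ S T : M.faces, S.1 ⊆ T.1 → f S ≤ f T
  submod : ∀ S T I U : M.faces, I.1 = S.1 ∩ T.1 → U.1 = S.1 ∪ T.1 → f I + f U ≤ f S + f T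

/-- A partial polymatroid is non-contextual if it is the restriction of a polymatroid. -/
def IsNonContextual {n : ℕ} (M : MarginalScenario n) (f : M.faces → ℝ) : Prop :=
  ∃ h : Finset (Fin n) → ℝ, IsPolymatroid h ∧ ∀ S : M.faces, f S = h S.1

/-- Summands of the Shannon entropy, in bits (with the convention `0 log 0 = 0`). -/
def entropySummand {β : Type} (p : PMF β) (b : β) : ℝ :=
  -((p b).toReal * Real.logb 2 (p b).toReal)

/-- The marginal distribution of the variables `A_i`, `i ∈ S`. -/
def marginal {n : ℕ} {α : Fin n → Type} (P : PMF (∀ i, α i)) (S : Finset (Fin n)) :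
    PMF (∀ i : S, α i) :=
  P.map fun a i => a i

/-- `f` is the entropy function `S ↦ H(A_S)` of discrete random variables `A_i`, given by their
joint distribution `P`. The outcome sets are finite or countable, and all the entropies
are finite (`HasSum`). -/
def IsEntropic {n : ℕ} (f : Finset (Fin n) → ℝ) : Prop :=
  ∃ (α : Fin n → Type) (_ : ∀ i, Countable (α i)) (P : PMF (∀ i, α i)),
    ∀ S, HasSum (entropySummand (marginal P S)) (f S)

/-- A function on `M` is entropic if it is the restriction of an entropic polymatroid. -/
def IsEntropicOn {n : ℕ} (M : MarginalScenario n) (f : M.faces → ℝ) : Prop :=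
  ∃ h : Finset (Fin n) → ℝ, IsPolymatroid h ∧ IsEntropic h ∧ ∀ S : M.faces, f S = h S.1

/-- The linear inequality `0 ≤ ∑ S, c S * H(A_S)` with coefficient vector `c` is a valid entropic
inequality: it holds for all discrete random variables with finite entropies. -/
def IsValidEntropicInequality {n : ℕ} (c : Finset (Fin n) → ℝ) : Prop :=
  ∀ f : Finset (Fin n) → ℝ, IsEntropic f → 0 ≤ ∑ S, c S * f S

/-- The coefficient vector of the term `H(A_S)`. -/
def term {n : ℕ} (S : Finset (Fin n)) : Finset (Fin n) → ℝ := Pi.single S 1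

/-- The coefficient vectors `c` of the basic inequalities, each in the form
`0 ≤ ∑ S, c S * H(A_S)`. -/
inductive IsBasicInequality {n : ℕ} : (Finset (Fin n) → ℝ) → Prop
  | nonneg (S : Finset (Fin n)) : IsBasicInequality (term S)
  | empty : IsBasicInequality (-term ∅)
  | mono (S T : Finset (Fin n)) (h : S ⊆ T) : IsBasicInequality (term T - term S)
  | submod (S T : Finset (Fin n)) :
      IsBasicInequality (term S + term T - term (S ∩ T) - term (S ∪ T))

/-- A linear inequality is Shannon-type if it is a finite non-negative linear combination of basic
inequalities. -/
def IsShannonType {n : ℕ} (c : Finset (Fin n) → ℝ) : Prop :=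
  ∃ (m : ℕ) (w : Fin m → ℝ) (b : Fin m → Finset (Fin n) → ℝ),
    (∀ k, 0 ≤ w k) ∧ (∀ k, IsBasicInequality (b k)) ∧ c = ∑ k, w k • b k

end

end EntropicCycle

/-!
On the sets `{j}` and `{j, j+1}` every polymatroid `h` on `[n]` agrees with a non-negative
combination `∑ T, w T * [S ∩ T ≠ ∅]` of rank-one covering functions, and `w` can be chosen integral
if `h` is integral on these sets. Both parts of the theorem follow.

Such a combination is the same thing as a family of sets `U j` in a finite measure space (an atom of
mass `w T` lies in exactly the `U j` with `j ∈ T`) such that `U j` has measure `h {j}` and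
`U j ∩ U (j+1)` has measure `I(j : j+1) = h {j} + h {j+1} - h {j, j+1}`. To construct the sets,
triangulate the cycle by the chords from vertex `0`, and prescribe the measure `c k = I(0 : k)` for
`U 0 ∩ U k`. For each triangle `0, k, k+1` submodularity yields inequalities (`IsTriangle`) under
which a set `U (k+1)` with the required intersections with `U 0` and `U k` can be added, whatever
the previous sets are (`exists_weights_path`): only the masses of the four cells cut out by `U 0`
and `U k` matter, and masses can be split freely. If `h` is only known to be integral on the cycle,
then the chords `c k` are rounded down; the inequalities of `IsTriangle` survive this, since the
data on the cycle are integers (`IsPolymatroid.exists_weights`).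

A covering function with integer weights is the entropy function of independent fair coins, the
variable `A_j` being the tuple of the coins in `U j` (`isEntropic_covering`). This gives the second
part. For the first, a valid inequality in the given terms holds for each `[S ∩ T ≠ ∅]`, hence for
all polymatroids, and Farkas' lemma turns this into a Shannon-type derivation
(`isShannonType_of_forall_isPolymatroid`).
-/

namespace EntropicCycle

/-! ### Farkas' lemma -/

/-- **Farkas' lemma** for finitely many linear functionals, by induction on their number. -/
theorem exists_nonneg_combination_of_forall_nonneg {V ι : Type*} [AddCommGroup V] [Module ℝ V]
    (s : Finset ι) (a : ι → V →ₗ[ℝ] ℝ) (b : V →ₗ[ℝ] ℝ)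
    (h : ∀ x, (∀ i ∈ s, 0 ≤ a i x) → 0 ≤ b x) :
    ∃ w : ι → ℝ, (∀ i, 0 ≤ w i) ∧ b = ∑ i ∈ s, w i • a i := by
  classical
  induction s using Finset.induction_on generalizing a b with
  | empty =>
    refine ⟨0, fun _ => le_rfl, ?_⟩
    ext x
    have h1 := h x (by simp)
    have h2 := h (-x) (by simp)
    simp only [map_neg] at h2
    simp only [Finset.sum_empty, LinearMap.zero_apply]
    linarith
  | insert j s hj ih =>
    by_cases hb : ∀ x, (∀ i ∈ s, 0 ≤ a i x) → 0 ≤ b x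
    · obtain ⟨w, hw, hbw⟩ := ih a b hb
      refine ⟨Function.update w j 0, fun i => ?_, ?_⟩
      · rcases eq_or_ne i j with rfl | hi
        · simp
        · simpa [hi] using hw i
      · rw [Finset.sum_insert hj, hbw]
        simp only [Function.update_self, zero_smul, zero_add]
        refine Finset.sum_congr rfl fun i hi => ?_
        rw [Function.update_of_ne (ne_of_mem_of_not_mem hi hj)]
    · push Not at hb
      obtain ⟨z, hz, hbz⟩ := hb
      have hjz : a j z < 0 := by
        by_contra hjz
        refine absurd (h z fun i hi => ?_) hbz.not_ge
        rcases Finset.mem_insert.1 hi with rfl | hi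
        · exact not_lt.1 hjz
        · exact hz i hi
      -- Project along `z` onto the kernel of `a j`; the other functionals still dominate `b` there.
      set t : ℝ := (-(a j z))⁻¹ with ht
      have ht0 : 0 < t := inv_pos.2 (by linarith)
      have htz : t * a j z = -1 := by
        rw [ht]; field_simp [hjz.ne]
      obtain ⟨w, hw, hbw⟩ := ih (fun i => a i + (t * a i z) • a j) (b + (t * b z) • a j) (by
        intro x hx
        have key := h (x + (t * a j x) • z) (by
          intro i hi
          rcases Finset.mem_insert.1 hi with rfl | hi
          · simp only [map_add, map_smul, smul_eq_mul]
            have : a i x + t * a i x * a i z = 0 := by linear_combination a i x * htz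
            exact this.ge
          · have := hx i hi
            simp only [map_add, map_smul, smul_eq_mul, LinearMap.add_apply,
              LinearMap.smul_apply] at this ⊢
            linarith)
        simp only [map_add, map_smul, smul_eq_mul, LinearMap.add_apply,
          LinearMap.smul_apply] at key ⊢
        linarith)
      have hw' : 0 ≤ (∑ i ∈ s, w i * (t * a i z)) - t * b z := by
        have h1 : 0 ≤ ∑ i ∈ s, w i * (t * a i z) :=
          Finset.sum_nonneg fun i hi => mul_nonneg (hw i) (mul_nonneg ht0.le (hz i hi))
        nlinarith
      refine ⟨Function.update w j ((∑ i ∈ s, w i * (t * a i z)) - t * b z), fun i => ?_, ?_⟩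
      · rcases eq_or_ne i j with rfl | hi
        · simpa using hw'
        · simpa [hi] using hw i
      · rw [Finset.sum_insert hj, Function.update_self]
        have h1 : ∑ i ∈ s, Function.update w j ((∑ i ∈ s, w i * (t * a i z)) - t * b z) i • a i
            = ∑ i ∈ s, w i • a i := by
          refine Finset.sum_congr rfl fun i hi => ?_
          rw [Function.update_of_ne (ne_of_mem_of_not_mem hi hj)]
        rw [h1]
        ext x
        have h2 := LinearMap.congr_fun hbw x
        simp only [LinearMap.add_apply, LinearMap.smul_apply, LinearMap.sum_apply, smul_eq_mul,
          mul_add, Finset.sum_add_distrib] at h2 ⊢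
        have h3 : ∑ i ∈ s, w i * (t * a i z * a j x) = (∑ i ∈ s, w i * (t * a i z)) * a j x := by
          rw [Finset.sum_mul]
          exact Finset.sum_congr rfl fun i _ => by ring
        rw [h3] at h2
        linarith

theorem finite_isBasicInequality (n : ℕ) :
    {b : Finset (Fin n) → ℝ | IsBasicInequality b}.Finite := by
  have h1 := Set.finite_range (fun S : Finset (Fin n) => term S)
  have h2 := Set.finite_range (fun S : Finset (Fin n) × Finset (Fin n) => term S.2 - term S.1)
  have h3 := Set.finite_range (fun S : Finset (Fin n) × Finset (Fin n) =>
    term S.1 + term S.2 - term (S.1 ∩ S.2) - term (S.1 ∪ S.2))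
  refine ((h1.union h2).union (h3.union (Set.finite_singleton (-term ∅)))).subset ?_
  rintro b (S | _ | ⟨S, T, h⟩ | ⟨S, T⟩)
  · exact Or.inl (Or.inl ⟨S, rfl⟩)
  · exact Or.inr (Or.inr rfl)
  · exact Or.inl (Or.inr ⟨(S, T), rfl⟩)
  · exact Or.inr (Or.inl ⟨(S, T), rfl⟩)

theorem sum_term_mul {n : ℕ} (S : Finset (Fin n)) (f : Finset (Fin n) → ℝ) :
    ∑ R, term S R * f R = f S := by
  simp [term, Pi.single_apply]

/-- A point of the dual cone of the basic inequalities is a polymatroid. -/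
theorem isPolymatroid_of_basic {n : ℕ} {f : Finset (Fin n) → ℝ}
    (h : ∀ b, IsBasicInequality b → 0 ≤ ∑ S, b S * f S) : IsPolymatroid f where
  nonneg S := by simpa [sum_term_mul] using h _ (.nonneg S)
  empty := by
    have h1 := h _ (.nonneg ∅)
    have h2 := h _ .empty
    simp only [Pi.neg_apply, neg_mul, Finset.sum_neg_distrib, sum_term_mul] at h1 h2
    linarith
  mono S T hST := by
    have h1 := h _ (.mono S T hST)
    simp only [Pi.sub_apply, sub_mul, Finset.sum_sub_distrib, sum_term_mul] at h1
    linarith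
  submod S T := by
    have h1 := h _ (.submod S T)
    simp only [Pi.sub_apply, Pi.add_apply, sub_mul, add_mul, Finset.sum_sub_distrib,
      Finset.sum_add_distrib, sum_term_mul] at h1
    linarith

/-- An inequality which holds for all polymatroids is Shannon-type: Farkas' lemma, applied to the
polyhedral cone of polymatroids. -/
theorem isShannonType_of_forall_isPolymatroid {n : ℕ} {c : Finset (Fin n) → ℝ}
    (hc : ∀ f, IsPolymatroid f → 0 ≤ ∑ S, c S * f S) : IsShannonType c := by
  classical
  set s := (finite_isBasicInequality n).toFinset with hs
  have hmem : ∀ b, b ∈ s ↔ IsBasicInequality b := fun b => by simp [hs]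
  let φ : (Finset (Fin n) → ℝ) → (Finset (Fin n) → ℝ) →ₗ[ℝ] ℝ := fun c =>
    ∑ S, c S • LinearMap.proj S
  have hφ : ∀ c f, φ c f = ∑ S, c S * f S := fun c f => by simp [φ]
  obtain ⟨w, hw, hcw⟩ := exists_nonneg_combination_of_forall_nonneg s φ (φ c) (by
    intro f hf
    rw [hφ]
    exact hc f (isPolymatroid_of_basic fun b hb => by
      rw [← hφ]; exact hf b ((hmem b).2 hb)))
  refine ⟨s.card, fun k => w (s.equivFin.symm k), fun k => (s.equivFin.symm k).1,
    fun k => hw _, fun k => (hmem _).1 (s.equivFin.symm k).2, ?_⟩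
  rw [Equiv.sum_comp s.equivFin.symm (fun b : s => w b.1 • b.1),
    Finset.sum_coe_sort s (fun b => w b • b)]
  ext S
  have h1 := LinearMap.congr_fun hcw (Pi.single S 1)
  simpa [hφ, LinearMap.sum_apply, Pi.single_apply] using h1

/-! ### Covering functions -/

/-- The covering function `S ↦ #{u | T u ∩ S ≠ ∅}` of a finite family `T` of subsets of `[n]`.
With `U i = {u | i ∈ T u}`, its value at `S` is the cardinality of `⋃ i ∈ S, U i`. -/
def covering {n : ℕ} {Ω : Type} [Fintype Ω] (T : Ω → Finset (Fin n)) (S : Finset (Fin n)) : ℝ :=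
  ((Finset.univ.filter fun u => ∃ i ∈ S, i ∈ T u).card : ℝ)

section Covering

variable {n : ℕ} {Ω : Type} [Fintype Ω]

theorem covering_eq_sum (T : Ω → Finset (Fin n)) (S : Finset (Fin n)) :
    covering T S = ∑ u, if ∃ i ∈ S, i ∈ T u then 1 else 0 := by
  simp [covering]

theorem isPolymatroid_covering (T : Ω → Finset (Fin n)) : IsPolymatroid (covering T) where
  nonneg _ := Nat.cast_nonneg _
  empty := by simp [covering]
  mono S S' h := by
    unfold covering
    gcongr
  submod S S' := by
    classical
    unfold covering
    norm_cast
    rw [← Finset.card_union_add_card_inter (Finset.univ.filter fun u => ∃ i ∈ S, i ∈ T u), add_comm]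
    refine add_le_add (Finset.card_le_card fun u => ?_) (Finset.card_le_card fun u => ?_)
    · simp only [Finset.mem_filter, Finset.mem_univ, true_and, Finset.mem_union]
      rintro ⟨i, hi | hi, hu⟩
      exacts [Or.inl ⟨i, hi, hu⟩, Or.inr ⟨i, hi, hu⟩]
    · simp only [Finset.mem_filter, Finset.mem_univ, true_and, Finset.mem_inter]
      rintro ⟨i, ⟨hi, hi'⟩, hu⟩
      exact ⟨⟨i, hi, hu⟩, ⟨i, hi', hu⟩⟩

/-- Covering functions are entropic: toss a fair coin for each `u : Ω`, independently, and let `A_i`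
record the coins with `i ∈ T u`. Then `A_S` determines, and is determined by, the coins with
`T u ∩ S ≠ ∅`, so each of its outcomes has probability `2 ^ (-covering T S)`. -/
theorem isEntropic_covering (T : Ω → Finset (Fin n)) : IsEntropic (covering T) := by
  classical
  let φ : (Ω → Bool) → (Fin n → Ω → Bool) := fun ω i u => if i ∈ T u then ω u else false
  refine ⟨fun _ => Ω → Bool, fun _ => inferInstance,
    (PMF.uniformOfFintype (Ω → Bool)).map φ, fun S => ?_⟩
  set p := marginal ((PMF.uniformOfFintype (Ω → Bool)).map φ) S with hp
  set R := Finset.univ.filter fun u => ∃ i ∈ S, i ∈ T u with hR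
  let ψ : (Ω → Bool) → (∀ _ : S, Ω → Bool) := fun ω i => φ ω i
  have hpψ : p = (PMF.uniformOfFintype (Ω → Bool)).map ψ := by
    rw [hp, marginal, PMF.map_comp]; rfl
  have hψ : ∀ ω ω', ψ ω' = ψ ω ↔ ∀ u ∈ R, ω' u = ω u := by
    intro ω ω'
    constructor
    · intro h u hu
      obtain ⟨i, hi, hiu⟩ := (Finset.mem_filter.1 hu).2
      simpa [ψ, φ, hiu] using congrFun (congrFun h ⟨i, hi⟩) u
    · intro h
      funext i u
      by_cases hiu : i.1 ∈ T u
      · simpa [ψ, φ, hiu] using h u (Finset.mem_filter.2 ⟨Finset.mem_univ _, i, i.2, hiu⟩)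
      · simp [ψ, φ, hiu]
  have hfiber : ∀ ω, (Finset.univ.filter fun ω' => ψ ω' = ψ ω).card * 2 ^ R.card
      = 2 ^ Fintype.card Ω := by
    intro ω
    have : (Finset.univ.filter fun ω' => ψ ω' = ψ ω)
        = Fintype.piFinset fun u => if u ∈ R then {ω u} else Finset.univ := by
      ext ω'
      simp only [Finset.mem_filter, Finset.mem_univ, true_and, hψ, Fintype.mem_piFinset]
      refine forall_congr' fun u => ?_
      by_cases hu : u ∈ R <;> simp [hu]
    rw [this, Fintype.card_piFinset]
    have h2 : ∀ u, (if u ∈ R then {ω u} else (Finset.univ : Finset Bool)).card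
        = if u ∈ R then 1 else 2 := fun u => by split_ifs <;> simp
    simp only [h2]
    rw [Finset.prod_ite, Finset.prod_const_one, one_mul, Finset.prod_const, ← pow_add]
    congr 1
    rw [Finset.filter_not, Finset.filter_mem_eq_inter, Finset.univ_inter,
      Finset.card_sdiff_add_card_eq_card (Finset.subset_univ _), Finset.card_univ]
  have hval : ∀ b, p b = 0 ∨ (p b).toReal = ((2 : ℝ) ^ R.card)⁻¹ := by
    intro b
    by_cases hb : ∃ ω, ψ ω = b
    · right
      obtain ⟨ω, rfl⟩ := hb
      have h1 : p (ψ ω) = ((Finset.univ.filter fun ω' => ψ ω' = ψ ω).card : ENNReal)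
          * ((2 : ENNReal) ^ Fintype.card Ω)⁻¹ := by
        rw [hpψ, PMF.map_apply, tsum_fintype, Finset.card_filter]
        push_cast
        rw [Finset.sum_mul]
        refine Finset.sum_congr rfl fun ω' _ => ?_
        simp only [PMF.uniformOfFintype_apply, Fintype.card_pi, Fintype.card_bool,
          Finset.prod_const, Finset.card_univ, eq_comm (a := ψ ω)]
        split_ifs <;> simp
      rw [h1, ENNReal.toReal_mul, ENNReal.toReal_inv, ENNReal.toReal_pow, ENNReal.toReal_natCast,
        ENNReal.toReal_ofNat]
      have h2 : ((Finset.univ.filter fun ω' => ψ ω' = ψ ω).card : ℝ) * 2 ^ R.card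
        = 2 ^ Fintype.card Ω := by exact_mod_cast hfiber ω
      rw [← h2]
      have h3 : ((Finset.univ.filter fun ω' => ψ ω' = ψ ω).card : ℝ) ≠ 0 := by
        intro h0
        rw [h0, zero_mul] at h2
        exact absurd h2.symm (by positivity)
      field_simp
    · left
      rw [hpψ, PMF.map_apply]
      refine ENNReal.tsum_eq_zero.2 fun ω => if_neg fun h => hb ⟨ω, h.symm⟩
  have hsummand : ∀ b, entropySummand p b = R.card * (p b).toReal := by
    intro b
    rcases hval b with h | h
    · simp [entropySummand, h]
    · rw [entropySummand, h, Real.logb_inv, Real.logb_pow, Real.logb_self_eq_one one_lt_two]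
      ring
  have hsum : HasSum (fun b => (p b).toReal) 1 := by
    have h := p.tsum_coe
    have h2 := ENNReal.hasSum_toReal (f := p) (by rw [h]; exact ENNReal.one_ne_top)
    rwa [← ENNReal.tsum_toReal_eq p.apply_ne_top, h, ENNReal.toReal_one] at h2
  have := hsum.mul_left (R.card : ℝ)
  rw [mul_one] at this
  rwa [← funext hsummand] at this

end Covering

/-! ### Gluing weighted set systems along a path -/

section Gluing

variable {K : Type*} [CommRing K]

/-- The total weight of the subsets of `{0, …, k}` with the property `F`. -/
def weightOf (k : ℕ) (m : Finset ℕ → K) (F : Finset ℕ → Prop) [DecidablePred F] : K :=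
  ∑ T ∈ (Finset.range (k + 1)).powerset with F T, m T

/-- Bookkeeping for adding the element `k + 1`: each cell `T` is split into `T`, of weight `d T`, and
`insert (k + 1) T`, of weight `t T`, and a new cell `{k + 1}` of weight `r` is created. -/
theorem weightOf_succ (k : ℕ) (t d : Finset ℕ → K) (r : K) (F : Finset ℕ → Prop)
    [DecidablePred F] (G : Finset ℕ → Prop) [DecidablePred G]
    (hG : ∀ T, G T ↔ F (insert (k + 1) T)) :
    weightOf (k + 1) (fun T => if k + 1 ∈ T then
      t (T.erase (k + 1)) + if T.erase (k + 1) = ∅ then r else 0 else d T) F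
      = weightOf k d F + weightOf k t G + if G ∅ then r else 0 := by
  unfold weightOf
  have hk : k + 1 ∉ Finset.range (k + 1) := by simp
  have hT : ∀ T ∈ (Finset.range (k + 1)).powerset, k + 1 ∉ T := fun T hT h =>
    hk (Finset.mem_powerset.1 hT h)
  simp only [Finset.sum_filter]
  rw [Finset.range_add_one (n := k + 1), Finset.sum_powerset_insert hk, add_assoc]
  congr 1
  · refine Finset.sum_congr rfl fun T h => ?_
    simp [hT T h]
  · have h1 : (∑ T ∈ (Finset.range (k + 1)).powerset, if T = ∅ then (if G ∅ then r else 0) else 0)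
        = if G ∅ then r else 0 := by
      rw [Finset.sum_ite_eq']
      simp
    rw [← h1, ← Finset.sum_add_distrib]
    refine Finset.sum_congr rfl fun T h => ?_
    simp only [Finset.mem_insert_self, if_true, Finset.erase_insert (hT T h), ← hG]
    by_cases hT0 : T = ∅
    · subst hT0
      by_cases hg : G ∅ <;> simp [hg]
    · simp [hT0]

theorem weightOf_sub (k : ℕ) (m t : Finset ℕ → K) (F : Finset ℕ → Prop) [DecidablePred F] :
    weightOf k (fun T => m T - t T) F = weightOf k m F - weightOf k t F :=
  Finset.sum_sub_distrib _ _

theorem weightOf_split (k : ℕ) (m : Finset ℕ → K) (F G : Finset ℕ → Prop)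
    [DecidablePred F] [DecidablePred G] :
    weightOf k m F = weightOf k m (fun T => F T ∧ G T) + weightOf k m (fun T => F T ∧ ¬ G T) := by
  unfold weightOf
  rw [← Finset.filter_filter, ← Finset.filter_filter, Finset.sum_filter_add_sum_filter_not]

theorem weightOf_eq_zero (k : ℕ) (m : Finset ℕ → K) (F : Finset ℕ → Prop) [DecidablePred F]
    (hF : ∀ T, F T → k + 1 ∈ T) : weightOf k m F = 0 := by
  refine Finset.sum_eq_zero fun T hT => ?_
  obtain ⟨h1, h2⟩ := Finset.mem_filter.1 hT
  have := Finset.mem_powerset.1 h1 (hF T h2)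
  simp at this

variable [LinearOrder K] [IsStrictOrderedRing K]

/-- A measure can be split: below the weight `m` there is one of any prescribed total mass `p`
between `0` and the mass of `m`. -/
theorem exists_le_sum_eq {ι : Type*} (s : Finset ι) (m : ι → K) (hm : ∀ i, 0 ≤ m i) (p : K)
    (hp : 0 ≤ p) (hps : p ≤ ∑ i ∈ s, m i) :
    ∃ t : ι → K, (∀ i, 0 ≤ t i) ∧ (∀ i, t i ≤ m i) ∧ ∑ i ∈ s, t i = p := by
  classical
  induction s using Finset.induction_on generalizing p with
  | empty => exact ⟨0, fun _ => le_rfl, hm, le_antisymm hp (by simpa using hps)⟩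
  | insert j s hj ih =>
    rw [Finset.sum_insert hj] at hps
    obtain ⟨t, ht0, htm, hts⟩ := ih (p - min p (m j)) (sub_nonneg.2 (min_le_left _ _)) (by
      rcases min_cases p (m j) with ⟨h, _⟩ | ⟨h, _⟩ <;> rw [h]
      · rw [sub_self]; exact Finset.sum_nonneg fun i _ => hm i
      · linarith)
    refine ⟨Function.update t j (min p (m j)), fun i => ?_, fun i => ?_, ?_⟩
    · rcases eq_or_ne i j with rfl | hi
      · simpa using ⟨hp, hm i⟩
      · simpa [hi] using ht0 i
    · rcases eq_or_ne i j with rfl | hi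
      · simp
      · simpa [hi] using htm i
    · rw [Finset.sum_insert hj, Function.update_self]
      have : ∑ i ∈ s, Function.update t j (min p (m j)) i = ∑ i ∈ s, t i :=
        Finset.sum_congr rfl fun i hi => by
          rw [Function.update_of_ne (ne_of_mem_of_not_mem hi hj)]
      rw [this, hts]
      ring

/-- The constraints on the measures `a`, `b`, `d` of three sets and on the measures `ab`, `bd`, `ad`
of their pairwise intersections: the sets exist if and only if all of these hold. -/
structure IsTriangle (a b d ab bd ad : K) : Prop where
  ab_nonneg : 0 ≤ ab
  bd_nonneg : 0 ≤ bd
  ad_nonneg : 0 ≤ ad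
  ab_le_left : ab ≤ a
  ab_le_right : ab ≤ b
  bd_le_left : bd ≤ b
  bd_le_right : bd ≤ d
  ad_le_left : ad ≤ a
  ad_le_right : ad ≤ d
  left : ab + ad - a ≤ bd
  middle : ab + bd - b ≤ ad
  right : ad + bd - d ≤ ab

/-- Sets `U 0, …, U N` with prescribed measures `x i`, such that `U i ∩ U (i + 1)` has measure `I i`
and `U 0 ∩ U N` has measure `c N`. Here `m T` is the measure of the cell of points which lie in
exactly the `U i` with `i ∈ T`. The sets are added one at a time; `c k` is the measure of
`U 0 ∩ U k`, and the only constraints are those of the triangles `0, k, k + 1`. -/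
theorem exists_weights_path (x I c : ℕ → K) (N : ℕ) (hx : 0 ≤ x 0) (hc : c 0 = x 0)
    (h : ∀ k < N, IsTriangle (x 0) (x k) (x (k + 1)) (c k) (I k) (c (k + 1))) :
    ∃ m : Finset ℕ → K, (∀ T, 0 ≤ m T) ∧ (∀ i ≤ N, weightOf N m (fun T => i ∈ T) = x i) ∧
      (∀ i < N, weightOf N m (fun T => i ∈ T ∧ i + 1 ∈ T) = I i) ∧
      weightOf N m (fun T => 0 ∈ T ∧ N ∈ T) = c N := by
  induction N with
  | zero =>
    refine ⟨fun T => if T = {0} then x 0 else 0, fun T => ?_, fun i hi => ?_, by simp, ?_⟩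
    · dsimp only
      split_ifs
      exacts [hx, le_rfl]
    · obtain rfl : i = 0 := by omega
      simp [weightOf]
    · simp [weightOf, hc]
  | succ k ih =>
    obtain ⟨m, hm, hmx, hmI, hmc⟩ := ih fun j hj => h j (by omega)
    have H := h k (by omega)
    have hx0 := hmx 0 (by omega)
    have hxk := hmx k le_rfl
    rw [weightOf_split k m _ (fun T => k ∈ T), hmc] at hx0
    rw [weightOf_split k m _ (fun T => 0 ∈ T)] at hxk
    have hcomm : ∀ m' : Finset ℕ → K, weightOf k m' (fun T => k ∈ T ∧ 0 ∈ T)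
        = weightOf k m' (fun T => 0 ∈ T ∧ k ∈ T) := fun m' => by simp only [and_comm]
    rw [hcomm, hmc] at hxk
    -- `p` and `q` are the measures of the parts of `U 0 ∩ U (k + 1)` inside and outside of `U k`.
    obtain ⟨p, q, hpq, hp0, hpc, hpI, hpx, hq0, hqx, hqd⟩ : ∃ p q : K, p + q = c (k + 1) ∧
        0 ≤ p ∧ p ≤ c k ∧ p ≤ I k ∧ I k - p ≤ x k - c k ∧
        0 ≤ q ∧ q ≤ x 0 - c k ∧ q ≤ x (k + 1) - I k := by
      obtain ⟨h1, h2, h3, h4, h5, h6, h7, h8, h9, h10, h11, h12⟩ := H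
      refine ⟨min (min (c k) (I k)) (c (k + 1)), c (k + 1) - min (min (c k) (I k)) (c (k + 1)),
        by ring, ?_⟩
      rcases min_cases (c k) (I k) with ⟨e, _⟩ | ⟨e, _⟩ <;> rw [e]
      on_goal 1 => rcases min_cases (c k) (c (k + 1)) with ⟨e, _⟩ | ⟨e, _⟩ <;> rw [e]
      on_goal 3 => rcases min_cases (I k) (c (k + 1)) with ⟨e, _⟩ | ⟨e, _⟩ <;> rw [e]
      all_goals refine ⟨?_, ?_, ?_, ?_, ?_, ?_, ?_⟩ <;> linarith
    obtain ⟨t₁, ht₁0, ht₁m, ht₁⟩ := exists_le_sum_eq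
      ((Finset.range (k + 1)).powerset.filter fun T => 0 ∈ T ∧ k ∈ T) m hm p hp0
      (hpc.trans_eq hmc.symm)
    obtain ⟨t₂, ht₂0, ht₂m, ht₂⟩ := exists_le_sum_eq
      ((Finset.range (k + 1)).powerset.filter fun T => k ∈ T ∧ 0 ∉ T) m hm (I k - p)
      (by linarith) (by unfold weightOf at hxk; linarith)
    obtain ⟨t₃, ht₃0, ht₃m, ht₃⟩ := exists_le_sum_eq
      ((Finset.range (k + 1)).powerset.filter fun T => 0 ∈ T ∧ k ∉ T) m hm q
      hq0 (by unfold weightOf at hx0; linarith)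
    -- `t` is the weight of the part of each cell which goes into `U (k + 1)`.
    let t : Finset ℕ → K := fun T =>
      if k ∈ T then (if 0 ∈ T then t₁ T else t₂ T) else (if 0 ∈ T then t₃ T else 0)
    have ht0 : ∀ T, 0 ≤ t T := fun T => by
      simp only [t]; split_ifs <;> simp [ht₁0, ht₂0, ht₃0]
    have htm : ∀ T, t T ≤ m T := fun T => by
      simp only [t]; split_ifs <;> simp [ht₁m, ht₂m, ht₃m, hm]
    have htp : weightOf k t (fun T => 0 ∈ T ∧ k ∈ T) = p := by
      rw [← ht₁]
      refine Finset.sum_congr rfl fun T hT => ?_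
      obtain ⟨_, h0, hk⟩ := Finset.mem_filter.1 hT
      simp [t, h0, hk]
    have htI : weightOf k t (fun T => k ∈ T ∧ 0 ∉ T) = I k - p := by
      rw [← ht₂]
      refine Finset.sum_congr rfl fun T hT => ?_
      obtain ⟨_, h0, hk⟩ := Finset.mem_filter.1 hT
      simp [t, h0, hk]
    have htq : weightOf k t (fun T => 0 ∈ T ∧ k ∉ T) = q := by
      rw [← ht₃]
      refine Finset.sum_congr rfl fun T hT => ?_
      obtain ⟨_, h0, hk⟩ := Finset.mem_filter.1 hT
      simp [t, h0, hk]
    have ht00 : weightOf k t (fun T => k ∉ T ∧ 0 ∉ T) = 0 := by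
      refine Finset.sum_eq_zero fun T hT => ?_
      obtain ⟨_, h0, hk⟩ := Finset.mem_filter.1 hT
      simp [t, h0, hk]
    have htk : weightOf k t (fun T => k ∈ T) = I k := by
      rw [weightOf_split k t _ (fun T => 0 ∈ T), hcomm, htp, htI]; ring
    have htz : weightOf k t (fun T => 0 ∈ T) = c (k + 1) := by
      rw [weightOf_split k t _ (fun T => k ∈ T), htp, htq, hpq]
    have htt : weightOf k t (fun _ => True) = I k + q := by
      have h1 := weightOf_split k t (fun _ => True) (fun T => k ∈ T)
      have h2 := weightOf_split k t (fun T => k ∉ T) (fun T => 0 ∈ T)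
      simp only [true_and] at h1
      simp only [and_comm (a := k ∉ _) (b := 0 ∈ _)] at h2
      rw [h1, htk, h2, htq, ht00, add_zero]
    refine ⟨fun T => if k + 1 ∈ T then t (T.erase (k + 1)) +
      if T.erase (k + 1) = ∅ then x (k + 1) - I k - q else 0 else m T - t T,
      fun T => ?_, fun i hi => ?_, fun i hi => ?_, ?_⟩
    · dsimp only
      split_ifs
      · exact add_nonneg (ht0 _) (by linarith)
      · simpa using ht0 _
      · exact sub_nonneg.2 (htm T)
    · rcases hi.lt_or_eq with hi | rfl
      · have hne : i ≠ k + 1 := by omega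
        rw [weightOf_succ k t _ _ _ (fun T => i ∈ T) (by simp [hne]), weightOf_sub]
        simpa using hmx i (by omega)
      · rw [weightOf_succ k t _ _ _ (fun _ => True) (by simp), htt, if_pos trivial,
          weightOf_eq_zero k _ _ fun _ => id]
        ring
    · rcases (Nat.lt_succ_iff.1 hi).lt_or_eq with hi | rfl
      · have hne : i ≠ k + 1 := by omega
        have hne' : i ≠ k := by omega
        rw [weightOf_succ k t _ _ _ (fun T => i ∈ T ∧ i + 1 ∈ T) (by simp [hne, hne']), weightOf_sub]
        simpa using hmI i hi
      · rw [weightOf_succ i t _ _ _ (fun T => i ∈ T) (by simp), htk,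
          weightOf_eq_zero i _ _ fun _ => And.right]
        simp
    · rw [weightOf_succ k t _ _ _ (fun T => 0 ∈ T) (by simp), htz,
        weightOf_eq_zero k _ _ fun _ => And.right]
      simp

end Gluing

/-! ### Polymatroids on the cycle -/

section Cycle

variable {n : ℕ} {h : Finset (Fin n) → ℝ}

/-- The mutual information `I(a : b)` of a set function. -/
def mutualInfo (h : Finset (Fin n) → ℝ) (a b : Fin n) : ℝ := h {a} + h {b} - h {a, b}

theorem mutualInfo_self (a : Fin n) : mutualInfo h a a = h {a} := by
  simp [mutualInfo]

theorem mutualInfo_comm (a b : Fin n) : mutualInfo h a b = mutualInfo h b a := by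
  rw [mutualInfo, mutualInfo, Finset.pair_comm, add_comm (h {a})]

theorem IsPolymatroid.mutualInfo_nonneg (hh : IsPolymatroid h) (a b : Fin n) :
    0 ≤ mutualInfo h a b := by
  have h1 := hh.submod {a} {b}
  have h2 := hh.nonneg ({a} ∩ {b})
  rw [← Finset.insert_eq] at h1
  rw [mutualInfo]
  linarith

theorem IsPolymatroid.mutualInfo_le_left (hh : IsPolymatroid h) (a b : Fin n) :
    mutualInfo h a b ≤ h {a} := by
  have h1 := hh.mono {b} {a, b} (by simp)
  rw [mutualInfo]
  linarith

theorem IsPolymatroid.mutualInfo_le_right (hh : IsPolymatroid h) (a b : Fin n) :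
    mutualInfo h a b ≤ h {b} := mutualInfo_comm (h := h) a b ▸ hh.mutualInfo_le_left b a

/-- The triangle inequality for mutual information of single elements: `H(b) + H(a, d)` is at most
`H(a, b) + H(b, d)`. -/
theorem IsPolymatroid.mutualInfo_add_le (hh : IsPolymatroid h) (a b d : Fin n) :
    mutualInfo h a b + mutualInfo h b d - h {b} ≤ mutualInfo h a d := by
  have h1 := hh.submod {a, b} {b, d}
  have h2 := hh.mono {b} ({a, b} ∩ {b, d}) (by simp)
  have h3 := hh.mono {a, d} ({a, b} ∪ {b, d}) (by
    intro i hi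
    simp only [Finset.mem_insert, Finset.mem_singleton, Finset.mem_union] at hi ⊢
    tauto)
  simp only [mutualInfo]
  linarith

theorem sum_weightOf {K : Type*} [CommRing K] (m : Finset ℕ → K) (N : ℕ) (F : Finset ℕ → Prop)
    [DecidablePred F] (G : Finset (Fin (N + 1)) → Prop) [DecidablePred G]
    (hFG : ∀ T, F (T.map Fin.valEmbedding) ↔ G T) :
    weightOf N m F = ∑ T with G T, m (T.map Fin.valEmbedding) := by
  symm
  refine Finset.sum_nbij (fun T => T.map Fin.valEmbedding) (fun T hT => ?_)
    (Finset.map_injective _).injOn (fun T hT => ?_) fun _ _ => rfl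
  · refine Finset.mem_filter.2 ⟨Finset.mem_powerset.2 fun i hi => ?_,
      (hFG T).2 (Finset.mem_filter.1 hT).2⟩
    obtain ⟨j, _, rfl⟩ := Finset.mem_map.1 hi
    exact Finset.mem_range.2 j.2
  · obtain ⟨h1, h2⟩ := Finset.mem_filter.1 hT
    have h3 : (Finset.univ.filter fun i : Fin (N + 1) => i.val ∈ T).map Fin.valEmbedding = T := by
      ext i
      simp only [Finset.mem_map, Finset.mem_filter, Finset.mem_univ, true_and,
        Fin.valEmbedding_apply]
      refine ⟨?_, fun hi => ⟨⟨i, Finset.mem_range.1 (Finset.mem_powerset.1 h1 hi)⟩, hi, rfl⟩⟩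
      rintro ⟨j, hj, rfl⟩
      exact hj
    exact ⟨_, by simpa using (hFG _).1 (h3.symm ▸ h2), h3⟩

/-- Every polymatroid on `[n]` agrees on the cycle with a combination of the functions
`S ↦ [S ∩ T ≠ ∅]` with non-negative coefficients `w T` in `K`, if it takes values in `K` there.
Here `K` is `ℝ` or `ℤ`, embedded by `ι`, and `r` rounds real numbers down to elements of `K`. -/
theorem IsPolymatroid.exists_weights [NeZero n] (hn : 2 ≤ n) (hh : IsPolymatroid h)
    {K : Type*} [CommRing K] [LinearOrder K] [IsStrictOrderedRing K]
    (ι : K →+* ℝ) (hι : StrictMono ι) (r : ℝ → K) (hr : GaloisConnection ι r)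
    (hx : ∀ j, ∃ z, h {j} = ι z) (hy : ∀ j, ∃ z, h {j, j + 1} = ι z) :
    ∃ w : Finset (Fin n) → K, (∀ T, 0 ≤ w T) ∧ ∀ S j, S ⊆ {j, j + 1} →
      h S = ∑ T, ι (w T) * if ∃ i ∈ S, i ∈ T then 1 else 0 := by
  choose x hx using hx
  choose y hy using hy
  have hI : ∀ j, mutualInfo h j (j + 1) = ι (x j + x (j + 1) - y j) := fun j => by
    rw [mutualInfo, hx, hx, hy, map_sub, map_add]
  obtain ⟨N, rfl⟩ : ∃ N, n = N + 1 := ⟨n - 1, by omega⟩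
  let v : ℕ → Fin (N + 1) := fun k => Fin.ofNat (N + 1) k
  have hv : ∀ k, v (k + 1) = v k + 1 := fun k => by
    apply Fin.ext; simp [v, Fin.val_add]
  have hvN : ∀ j : Fin (N + 1), v j = j := fun j => by
    apply Fin.ext; simp [v]
  have hlast : v N + 1 = v 0 := by rw [← hv]; apply Fin.ext; simp [v]
  let I : Fin (N + 1) → K := fun j => x j + x (j + 1) - y j
  let c : ℕ → K := fun k => r (mutualInfo h (v 0) (v k))
  have hrι : ∀ a, r (ι a) = a := fun a =>
    le_antisymm (hι.le_iff_le.1 (hr.l_u_le _)) (hr.le_u le_rfl)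
  have hc : ∀ k, ι (c k) ≤ mutualInfo h (v 0) (v k) := fun k => hr.l_u_le _
  obtain ⟨m, hm, hmx, hmI, hmc⟩ := exists_weights_path (fun k => x (v k)) (fun k => I (v k)) c N
    (hι.le_iff_le.1 (by rw [map_zero, ← hx]; exact hh.nonneg _))
    (by simp only [c]; rw [mutualInfo_self, hx, hrι]) (by
      intro k _
      have hIk : mutualInfo h (v k) (v (k + 1)) = ι (I (v k)) := by rw [hv, hI]
      have h0 := hh.mutualInfo_nonneg (v k) (v (k + 1))
      have h1 := hh.mutualInfo_le_left (v 0) (v k)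
      have h2 := hh.mutualInfo_le_right (v 0) (v k)
      have h3 := hh.mutualInfo_le_left (v k) (v (k + 1))
      have h4 := hh.mutualInfo_le_right (v k) (v (k + 1))
      have h5 := hh.mutualInfo_le_left (v 0) (v (k + 1))
      have h6 := hh.mutualInfo_le_right (v 0) (v (k + 1))
      have h7 := hh.mutualInfo_add_le (v k) (v 0) (v (k + 1))
      have h8 := hh.mutualInfo_add_le (v 0) (v k) (v (k + 1))
      have h9 := hh.mutualInfo_add_le (v 0) (v (k + 1)) (v k)
      rw [mutualInfo_comm (v k) (v 0)] at h7
      rw [mutualInfo_comm (v (k + 1)) (v k)] at h9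
      simp only [hIk, hx] at h0 h1 h2 h3 h4 h5 h6 h7 h8 h9
      have hck := hc k
      have hck' := hc (k + 1)
      -- Lower bounds on the rounded `c` hold by adjunction, as they only involve elements of `K` and
      -- other rounded values; upper bounds survive rounding down.
      constructor
      · exact hr.le_u (by rw [map_zero]; exact hh.mutualInfo_nonneg _ _)
      · exact hι.le_iff_le.1 (by rwa [map_zero])
      · exact hr.le_u (by rw [map_zero]; exact hh.mutualInfo_nonneg _ _)
      · exact hι.le_iff_le.1 (by linarith)
      · exact hι.le_iff_le.1 (by linarith)
      · exact hι.le_iff_le.1 h3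
      · exact hι.le_iff_le.1 h4
      · exact hι.le_iff_le.1 (by linarith)
      · exact hι.le_iff_le.1 (by linarith)
      · exact hι.le_iff_le.1 (by rw [map_sub, map_add]; linarith)
      · exact hr.le_u (by rw [map_sub, map_add]; linarith)
      · exact hr.le_u (by rw [map_sub, map_add]; linarith))
  have hmem : ∀ (j : Fin (N + 1)) (T : Finset (Fin (N + 1))),
      j.val ∈ T.map Fin.valEmbedding ↔ j ∈ T := fun j T => Finset.mem_map' Fin.valEmbedding
  set w : Finset (Fin (N + 1)) → K := fun T => m (T.map Fin.valEmbedding) with hw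
  have hwx : ∀ j, ∑ T with j ∈ T, w T = x j := by
    intro j
    rw [← sum_weightOf m N (fun T => j.val ∈ T) _ (hmem j), hmx _ (by omega), hvN]
  have hwI : ∀ j, ∑ T with j ∈ T ∧ j + 1 ∈ T, w T = I j := by
    intro j
    by_cases hj : j.val < N
    · rw [← sum_weightOf m N (fun T => j.val ∈ T ∧ j.val + 1 ∈ T) _ ?_, hmI _ hj, hvN]
      intro T
      have h1 : j.val + 1 = (j + 1).val := by
        rw [Fin.val_add_one_of_lt (by simpa [Fin.lt_def] using hj)]
      rw [h1, hmem, hmem]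
    -- The closing edge `{n - 1, 0}` is the last chord.
    · have hjN : j = v N := by
        rw [← hvN j]; congr 1; omega
      subst hjN
      rw [hlast, ← sum_weightOf m N (fun T => 0 ∈ T ∧ N ∈ T) _ ?_, hmc]
      · simp only [c]
        rw [mutualInfo_comm, ← hlast, hI, hrι]
      · intro T
        have h0 : (v 0).val = 0 := by simp [v]
        have hN : (v N).val = N := by simp [v]
        rw [← hmem, ← hmem (v 0), h0, hN, and_comm]
  refine ⟨w, fun T => hm _, fun S j hS => ?_⟩
  have hx' : ∀ j, h {j} = ∑ T, ι (w T) * if j ∈ T then 1 else 0 := fun j => by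
    rw [hx, ← hwx, map_sum, Finset.sum_filter]
    simp
  have hy' : h {j, j + 1} = h {j} + h {j + 1} -
      ∑ T, ι (w T) * if j ∈ T ∧ j + 1 ∈ T then 1 else 0 := by
    have h1 := hI j
    have h2 : ∑ T, ι (w T) * (if j ∈ T ∧ j + 1 ∈ T then 1 else 0) = ι (I j) := by
      rw [← hwI, map_sum, Finset.sum_filter]
      simp
    rw [h2]
    simp only [mutualInfo, I] at h1 ⊢
    linarith
  have hS' : S = ∅ ∨ S = {j} ∨ S = {j + 1} ∨ S = {j, j + 1} := by
    have h1 : (S : Set (Fin (N + 1))) ⊆ {j, j + 1} := fun i hi => by simpa using hS hi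
    exact_mod_cast Set.subset_pair_iff_eq.1 h1
  rcases hS' with rfl | rfl | rfl | rfl
  · simp [hh.empty]
  · simp [hx']
  · simp [hx' (j + 1)]
  · rw [hy', hx', hx', ← Finset.sum_add_distrib, ← Finset.sum_sub_distrib]
    refine Finset.sum_congr rfl fun T _ => ?_
    by_cases h1 : j ∈ T <;> by_cases h2 : j + 1 ∈ T <;> simp [h1, h2]

end Cycle

end EntropicCycle

/-! ### Inequalities and integer-valued functions on the cycle -/

theorem corollary5p3 (n : ℕ) [NeZero n] (hn : 3 ≤ n) :
    -- valid entropic inequalities in the terms `H(A_j)` and `H(A_j A_{j+1})` are Shannon-type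
    (∀ c : Finset (Fin n) → ℝ,
      (∀ S, c S ≠ 0 → ∃ j : Fin n, S = {j} ∨ S = {j, j + 1}) →
      EntropicCycle.IsValidEntropicInequality c →
      EntropicCycle.IsShannonType c) ∧
    -- integer-valued non-contextual partial polymatroids on the cycle
    (∀ f : (EntropicCycle.cycleScenario n).faces → ℝ,
      EntropicCycle.IsPartialPolymatroid (EntropicCycle.cycleScenario n) f →
      EntropicCycle.IsNonContextual (EntropicCycle.cycleScenario n) f →
      (∀ S, ∃ z : ℤ, f S = z) →
      -- are sums of entropic polymatroids with values in `{0, 1}`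
      (∃ (m : ℕ) (g : Fin m → Finset (Fin n) → ℝ),
        (∀ k, EntropicCycle.IsPolymatroid (g k) ∧ EntropicCycle.IsEntropic (g k) ∧
          ∀ S, g k S = 0 ∨ g k S = 1) ∧
        ∀ S : (EntropicCycle.cycleScenario n).faces, f S = ∑ k, g k S.1) ∧
      -- and are entropic
      EntropicCycle.IsEntropicOn (EntropicCycle.cycleScenario n) f) := by
  have hone : ∀ T S : Finset (Fin n), EntropicCycle.covering (fun _ : Unit => T) S
      = if ∃ i ∈ S, i ∈ T then 1 else 0 := fun T S => by
    simp [EntropicCycle.covering_eq_sum]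
  refine ⟨fun c hcS hc => EntropicCycle.isShannonType_of_forall_isPolymatroid fun h hh => ?_,
    fun f _ hf hfz => ?_⟩
  · obtain ⟨w, hw, hhw⟩ := hh.exists_weights (by omega) (RingHom.id ℝ) strictMono_id id
      GaloisConnection.id (fun j => ⟨_, rfl⟩) (fun j => ⟨_, rfl⟩)
    have h1 : ∀ S, c S * h S = ∑ T, w T * (c S * if ∃ i ∈ S, i ∈ T then 1 else 0) := by
      intro S
      by_cases hS : c S = 0
      · simp [hS]
      · obtain ⟨j, hj⟩ := hcS S hS
        rw [hhw S j (by rcases hj with rfl | rfl <;> simp), Finset.mul_sum]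
        refine Finset.sum_congr rfl fun T _ => ?_
        simp only [RingHom.id_apply]
        ring
    simp only [h1]
    -- It remains to check the inequality for each `S ↦ [S ∩ T ≠ ∅]`, the entropy
    -- function of one coin.
    rw [Finset.sum_comm]
    refine Finset.sum_nonneg fun T _ => ?_
    rw [← Finset.mul_sum]
    have h2 := hc _ (EntropicCycle.isEntropic_covering fun _ : Unit => T)
    simp only [hone] at h2
    exact mul_nonneg (hw T) h2
  · obtain ⟨h, hh, hfh⟩ := hf
    have hface : ∀ S j, S ⊆ {j, j + 1} → S ∈ (EntropicCycle.cycleScenario n).faces :=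
      fun S j hS => ⟨_, ⟨j, rfl⟩, hS⟩
    have hz : ∀ S j, S ⊆ {j, j + 1} → ∃ z : ℤ, h S = Int.castRingHom ℝ z := fun S j hS => by
      obtain ⟨z, hz⟩ := hfz ⟨S, hface S j hS⟩
      exact ⟨z, (hfh ⟨S, hface S j hS⟩).symm.trans hz⟩
    obtain ⟨w, hw, hhw⟩ := hh.exists_weights (by omega) (Int.castRingHom ℝ) Int.cast_strictMono
      Int.floor Int.gc_coe_floor (fun j => hz {j} j (by simp)) (fun j => hz _ j subset_rfl)
    -- The covering family which consists of `w T` copies of each set `T`.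
    let Ω := Σ T : Finset (Fin n), Fin (w T).toNat
    have hsum : ∀ S : (EntropicCycle.cycleScenario n).faces,
        f S = EntropicCycle.covering (fun u : Ω => u.1) S.1 := by
      rintro ⟨S, _, ⟨j, rfl⟩, hS⟩
      rw [hfh, hhw S j hS, EntropicCycle.covering_eq_sum, Fintype.sum_sigma]
      refine Finset.sum_congr rfl fun T _ => ?_
      have h1 : (((w T).toNat : ℤ) : ℝ) = (w T : ℝ) := by rw [Int.toNat_of_nonneg (hw T)]
      change _ = ∑ _ : Fin (w T).toNat, if ∃ i ∈ S, i ∈ T then (1 : ℝ) else 0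
      rw [Finset.sum_const, Finset.card_univ, Fintype.card_fin, nsmul_eq_mul, eq_intCast, ← h1,
        Int.cast_natCast]
    refine ⟨⟨Fintype.card Ω, fun k => EntropicCycle.covering
      (fun _ : Unit => ((Fintype.equivFin Ω).symm k).1), fun k =>
        ⟨EntropicCycle.isPolymatroid_covering _, EntropicCycle.isEntropic_covering _, fun S => ?_⟩, fun S => ?_⟩,
      _, EntropicCycle.isPolymatroid_covering _, EntropicCycle.isEntropic_covering _, hsum⟩
    · simp only [hone]
      split_ifs <;> simp
    · rw [hsum, EntropicCycle.covering_eq_sum]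
      simp only [hone]
      exact (Equiv.sum_comp (Fintype.equivFin Ω).symm
        (fun u : Ω => if ∃ i ∈ S.1, i ∈ u.1 then (1 : ℝ) else 0)).symm
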